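/- In one-server Private Information Retrieval (PIR), the user has an index $i\in[n]$, the server has a database $x\in\{0,1\}^n$, and the user has to output $x_i$. A quantum protocol for this task (without prior entanglement) uses the user's workspace $A$, a message register $M$ and the server's workspace $B$, all made of qubits initially in state $|0\rangle$. In round $k=1,2,\dots$ one player (the user if $k$ is odd, the server if $k$ is even) applies a unitary depending on his classical input to his workspace and $M$, and sends $M$ to the other player. After the last round (a message of the server) the user obtains his output by a measurement of $A$ and $M$. The communication complexity is the total number of qubits sent. Let the classical registers $I,X$ hold the inputs $(i,x)$, drawn from a distribution $\mu$, and let $A_k,M_k,B_k$ denote the registers $A,M,B$ at round $k$. The privacy losses (amounts of information leaked) of the user and of the server are $$L_U=\sum_{k\text{ odd}} I(M_k:I\mid X,B_k),\qquad L_S=\sum_{k\text{ even}} I(M_k:X\mid I,A_k),$$ where $I(P:Q\mid R)=S(PR)+S(QR)-S(R)-S(PQR)$ and $S$ is the von Neumann entropy in bits. **Corollary.** There exists a one-server quantum protocol for Private Information Retrieval (one for each database size $n$; the user outputs $x_i$ with certainty for all $i$ and $x$) with communication complexity $O(\log^2(n)\cdot\log\log(n))$, such that, for every input distribution $\mu$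 (in particular the uniform one): - the user leaks no information: $L_U=0$; - the server leaks $O(\mathrm{polylog}(n))$ information: $L_S\le C\,(\log n)^{c}$ for all large $n$, where the constants $c, C$ depend neither on $n$ nor on $\mu$. -/

import Mathlib

open scoped Matrix
open Filter Asymptotics

noncomputable section

namespace QPIR

/-! ### Reduced states, entropy and conditional mutual information -/

/-- Partial trace. The index type `ι` of a composite register is split by `e` into a part `κ`
which is kept and a part `τ` which is traced out. -/
def reducedState {ι κ τ : Type} [Fintype τ] (e : ι ≃ κ × τ) (ρ : Matrix ι ι ℂ) :
    Matrix κ κ ℂ :=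
  Matrix.of fun a a' => ∑ t, ρ (e.symm (a, t)) (e.symm (a', t))

theorem reducedState_isHermitian {ι κ τ : Type} [Fintype τ] (e : ι ≃ κ × τ)
    {ρ : Matrix ι ι ℂ} (h : ρ.IsHermitian) : (reducedState e ρ).IsHermitian := by
  ext a a'
  simp only [reducedState, Matrix.conjTranspose_apply, Matrix.of_apply, star_sum]
  exact Finset.sum_congr rfl fun t _ => h.apply _ _

/-- The von Neumann entropy `S(ρ) = - Tr (ρ log₂ ρ)`, in bits, computed from the spectrum of `ρ`.
It is only used for density matrices, which are Hermitian; on other matrices it is set to `0`. -/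
def entropy {ι : Type} [Fintype ι] [DecidableEq ι] (ρ : Matrix ι ι ℂ) : ℝ :=
  open Classical in
  if h : ρ.IsHermitian then (∑ j, Real.negMulLog (h.eigenvalues j)) / Real.log 2 else 0

/-- For a state `ρ` of three registers `P`, `Q`, `R` (in this order), the conditional mutual
information `I(P : Q | R) = S(PR) + S(QR) - S(R) - S(PQR)`. -/
def condMutualInfo {P Q R : Type} [Fintype P] [DecidableEq P] [Fintype Q] [DecidableEq Q]
    [Fintype R] [DecidableEq R] (ρ : Matrix (P × Q × R) (P × Q × R) ℂ) : ℝ :=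
  entropy (reducedState
      (⟨fun s => ((s.1, s.2.2), s.2.1), fun s => (s.1.1, s.2, s.1.2),
        fun _ => rfl, fun _ => rfl⟩ : P × Q × R ≃ (P × R) × Q) ρ)
    + entropy (reducedState (Equiv.prodComm P (Q × R)) ρ)
    - entropy (reducedState
      (⟨fun s => (s.2.2, (s.1, s.2.1)), fun s => (s.2.1, s.2.2, s.1),
        fun _ => rfl, fun _ => rfl⟩ : P × Q × R ≃ R × (P × Q)) ρ)
    - entropy ρ

/-! ### Two-party quantum protocols -/

/-- The computational basis of a register of `q` qubits. -/
abbrev Bits (q : ℕ) : Type := Fin q → Bool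

/-- A two-party quantum protocol without prior entanglement, where Alice has a classical input in
`X`, Bob has a classical input in `Y`, and Alice outputs an element of `Z`.

There are three registers of qubits: Alice's workspace `A`, the message register `M` and Bob's
workspace `B`. In round `k = 1, …, rounds` one player (Alice if `k` is odd, Bob if `k` is even)
applies a unitary, which may depend on his input, to his workspace and the message register, and
then sends the message register to the other player. The last message is sent by Bob. Then Alice
applies a unitary `aliceFinal` to `A` and `M`, measures these registers in the computational basis
and computes her output from the outcome and her input.

Only the values `aliceOp k` for `k` odd and `bobOp k` for `k` even are used. -/
structure Protocol (X Y Z : Type) where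
  qubitsA : ℕ
  qubitsM : ℕ
  qubitsB : ℕ
  rounds : ℕ
  rounds_even : Even rounds
  aliceOp : ℕ → X → Matrix.unitaryGroup (Bits qubitsA × Bits qubitsM) ℂ
  bobOp : ℕ → Y → Matrix.unitaryGroup (Bits qubitsM × Bits qubitsB) ℂ
  aliceFinal : X → Matrix.unitaryGroup (Bits qubitsA × Bits qubitsM) ℂ
  output : X → Bits qubitsA × Bits qubitsM → Z

namespace Protocol

variable {X Y Z : Type}

/-- The computational basis of Alice's workspace. -/
abbrev RegA (π : Protocol X Y Z) : Type := Bits π.qubitsA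

/-- The computational basis of the message register. -/
abbrev RegM (π : Protocol X Y Z) : Type := Bits π.qubitsM

/-- The computational basis of Bob's workspace. -/
abbrev RegB (π : Protocol X Y Z) : Type := Bits π.qubitsB

/-- The vectors of amplitudes of the three registers `A`, `M`, `B`. -/
abbrev Ket (π : Protocol X Y Z) : Type := π.RegA × π.RegM × π.RegB → ℂ

/-- The operator `U ⊗ 1` applied to a vector, where `U` acts on `A` and `M`. -/
def applyAlice (π : Protocol X Y Z) (U : Matrix.unitaryGroup (π.RegA × π.RegM) ℂ) (φ : π.Ket) :
    π.Ket :=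
  fun s => ((U : Matrix (π.RegA × π.RegM) (π.RegA × π.RegM) ℂ) *ᵥ
    fun r => φ (r.1, r.2, s.2.2)) (s.1, s.2.1)

/-- The operator `1 ⊗ V` applied to a vector, where `V` acts on `M` and `B`. -/
def applyBob (π : Protocol X Y Z) (V : Matrix.unitaryGroup (π.RegM × π.RegB) ℂ) (φ : π.Ket) :
    π.Ket :=
  fun s => ((V : Matrix (π.RegM × π.RegB) (π.RegM × π.RegB) ℂ) *ᵥ
    fun r => φ (s.1, r)) s.2

/-- The pure state of the registers `A`, `M`, `B` at round `k` (after the unitary of round `k`) on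
inputs `x`, `y`. Initially all the qubits are in the state `0`. -/
def state (π : Protocol X Y Z) (x : X) (y : Y) : ℕ → π.Ket
  | 0 => Pi.single ((fun _ => false), (fun _ => false), (fun _ => false)) 1
  | k + 1 =>
    if Odd (k + 1) then π.applyAlice (π.aliceOp (k + 1) x) (π.state x y k)
    else π.applyBob (π.bobOp (k + 1) y) (π.state x y k)

/-- The number of qubits exchanged: each round consists in sending the register `M`. -/
def communication (π : Protocol X Y Z) : ℕ := π.rounds * π.qubitsM

/-- The probability that Alice outputs `z` on inputs `x`, `y`. -/
def outputProb [DecidableEq Z] (π : Protocol X Y Z) (x : X) (y : Y) (z : Z) : ℝ :=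
  ∑ s : π.RegA × π.RegM × π.RegB,
    if π.output x (s.1, s.2.1) = z
    then ‖π.applyAlice (π.aliceFinal x) (π.state x y π.rounds) s‖ ^ 2 else 0

/-- Alice's output is `f x y` with certainty, for all inputs. -/
def Computes [DecidableEq Z] (π : Protocol X Y Z) (f : X → Y → Z) : Prop :=
  ∀ x y, π.outputProb x y (f x y) = 1

/-- The joint state
`∑ x y, μ (x, y) • |x⟩⟨x| ⊗ |y⟩⟨y| ⊗ |φ x y⟩⟨φ x y|`
of the classical input registers `X`, `Y` and the registers `A`, `M`, `B` at round `k`, when the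
inputs are distributed according to `μ`. -/
def jointState [DecidableEq X] [DecidableEq Y] (π : Protocol X Y Z) (μ : X × Y → ℝ) (k : ℕ) :
    Matrix (X × Y × π.RegA × π.RegM × π.RegB) (X × Y × π.RegA × π.RegM × π.RegB) ℂ :=
  Matrix.of fun s t =>
    if s.1 = t.1 ∧ s.2.1 = t.2.1
    then (μ (s.1, s.2.1) : ℂ) * π.state s.1 s.2.1 k s.2.2 * star (π.state s.1 s.2.1 k t.2.2)
    else 0

theorem jointState_isHermitian [DecidableEq X] [DecidableEq Y] (π : Protocol X Y Z)
    (μ : X × Y → ℝ) (k : ℕ) : (π.jointState μ k).IsHermitian := by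
  ext ⟨x, y, s⟩ ⟨x', y', t⟩
  simp only [jointState, Matrix.conjTranspose_apply, Matrix.of_apply]
  by_cases h : x = x' ∧ y = y'
  · obtain ⟨rfl, rfl⟩ := h
    simp
    ring
  · have h' : ¬ (x' = x ∧ y' = y) := fun h' => h ⟨h'.1.symm, h'.2.symm⟩
    simp [h, h']

variable [Fintype X] [DecidableEq X] [Fintype Y] [DecidableEq Y]

/-- Alice's privacy loss `∑_{k odd} I(M_k : X | Y, B_k)` under the input distribution `μ`. -/
def lossA (π : Protocol X Y Z) (μ : X × Y → ℝ) : ℝ :=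
  ∑ k ∈ (Finset.Icc 1 π.rounds).filter (fun k => Odd k),
    condMutualInfo (reducedState
      (⟨fun s => ((s.2.2.2.1, s.1, (s.2.1, s.2.2.2.2)), s.2.2.1),
        fun s => (s.1.2.1, s.1.2.2.1, s.2, s.1.1, s.1.2.2.2),
        fun _ => rfl, fun _ => rfl⟩ :
        X × Y × π.RegA × π.RegM × π.RegB ≃ (π.RegM × X × (Y × π.RegB)) × π.RegA)
      (π.jointState μ k))

/-- Bob's privacy loss `∑_{k even} I(M_k : Y | X, A_k)` under the input distribution `μ`. -/
def lossB (π : Protocol X Y Z) (μ : X × Y → ℝ) : ℝ :=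
  ∑ k ∈ (Finset.Icc 1 π.rounds).filter (fun k => Even k),
    condMutualInfo (reducedState
      (⟨fun s => ((s.2.2.2.1, s.2.1, (s.1, s.2.2.1)), s.2.2.2.2),
        fun s => (s.1.2.2.1, s.1.2.1, s.1.2.2.2, s.1.1, s.2),
        fun _ => rfl, fun _ => rfl⟩ :
        X × Y × π.RegA × π.RegM × π.RegB ≃ (π.RegM × Y × (X × π.RegA)) × π.RegB)
      (π.jointState μ k))

end Protocol

/-- The index function of Private Information Retrieval: the user (Alice) has an index `i`, the
server (Bob) has a database `x` of `n` bits, and the user outputs the bit `x i`. -/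
def index (n : ℕ) (i : Fin n) (x : Fin n → Bool) : Bool := x i

end QPIR

end

namespace QPIR

open scoped ComplexOrder

/-! ### Shannon entropy estimates -/

/-! The protocol is the classical polynomial scheme for many servers, played with a single server
that keeps nothing between rounds. The index `i` becomes a point `b` of `F ^ m` with 0/1 coordinates
and the database becomes its multilinear extension, where `m` is about `log n` and `|F| = 2 ^ s` is
at least `m + 2`. On a line `b + t r` the extension is a polynomial `p` in `t` of degree at most `m
< |F| - 1`. Power sums over `F` with exponent below `|F| - 1` vanish, so the values `p t` at the
points `t ≠ 0` add up to `-p 0`, which is minus the wanted bit. The user asks for these values one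
at a time, with `r` in uniform superposition, and keeps the coins `r` and the returned messages.

User privacy: for `t ≠ 0` the point `b + t r` is uniform whatever `i` is, and the coins in the
user's memory make the branches orthogonal. The message in transit is therefore in a fixed diagonal
state, and the server has no workspace for it to be correlated with (`askProtocol_lossA_eq_zero`,
`condMutualInfo_diagonal_mul`).

Server privacy: only sizes matter. The entropy of the classical inputs cancels in the conditional
mutual information, so a round leaks at most the number of qubits of `M`, plus twice that of `A`,
plus `log n` (`condMutualInfo_classical_le`, `Protocol.lossB_le`). Since `|F|` is `O(log n)`, there
are `O(log n)` rounds of `s (m + 1)` qubits and all registers have polylogarithmic size. -/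

theorem negMulLog_sum_le {ι : Type} [Fintype ι] {w : ι → ℝ} (hw : ∀ j, 0 ≤ w j) :
    Real.negMulLog (∑ j, w j) ≤ ∑ j, Real.negMulLog (w j) := by
  have h : ∀ j, w j * -Real.log (∑ j, w j) ≤ Real.negMulLog (w j) := by
    intro j
    rcases (hw j).eq_or_lt with h0 | h0
    · simp [← h0]
    · have := Real.log_le_log h0 (Finset.single_le_sum (fun i _ => hw i) (Finset.mem_univ j))
      rw [Real.negMulLog]
      nlinarith
  calc Real.negMulLog (∑ j, w j) = ∑ j, w j * -Real.log (∑ j, w j) := by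
        rw [← Finset.sum_mul, Real.negMulLog]; ring
    _ ≤ _ := Finset.sum_le_sum fun j _ => h j

/-- Jensen's inequality with uniform weights. The total mass is left free because the bound is
applied to unnormalised blocks, whose trace is a probability. -/
theorem sum_negMulLog_le {ι : Type} [Fintype ι] {w : ι → ℝ} (hw : ∀ j, 0 ≤ w j) :
    ∑ j, Real.negMulLog (w j) ≤
      Real.negMulLog (∑ j, w j) + (∑ j, w j) * Real.log (Fintype.card ι) := by
  rcases isEmpty_or_nonempty ι with h | h
  · simp
  have hd : (0 : ℝ) < Fintype.card ι := by exact_mod_cast Fintype.card_pos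
  have key := Real.concaveOn_negMulLog.le_map_sum (t := Finset.univ)
    (w := fun _ : ι => (Fintype.card ι : ℝ)⁻¹) (p := w) (fun _ _ => by positivity)
    (by simp [hd.ne']) (fun j _ => hw j)
  simp only [smul_eq_mul, ← Finset.mul_sum] at key
  rw [Real.negMulLog_mul, Real.negMulLog, Real.log_inv] at key
  have := mul_le_mul_of_nonneg_left key hd.le
  field_simp at this
  linarith

theorem sum_negMulLog_mul {α β : Type} [Fintype α] [Fintype β] (s : α → ℝ) (ν : β → ℝ) :
    ∑ x : α × β, Real.negMulLog (s x.1 * ν x.2) =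
      (∑ a, Real.negMulLog (s a)) * (∑ b, ν b) + (∑ a, s a) * ∑ b, Real.negMulLog (ν b) := by
  simp only [Real.negMulLog_mul, Fintype.sum_prod_type, Finset.sum_add_distrib, ← Finset.sum_mul,
    ← Finset.mul_sum]
  ring

/-! ### Von Neumann entropy from the spectrum -/

/-- With the entropy read off the characteristic polynomial, invariance under relabelling and
additivity over blocks need no matching of eigenvalue orderings. -/
theorem entropy_eq_sum_roots {ι : Type} [Fintype ι] [DecidableEq ι] {ρ : Matrix ι ι ℂ}
    (h : ρ.IsHermitian) :
    entropy ρ = (ρ.charpoly.roots.map fun z => Real.negMulLog z.re).sum / Real.log 2 := by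
  rw [entropy, dif_pos h, h.roots_charpoly_eq_eigenvalues, Multiset.map_map]
  rfl

theorem entropy_reindex {ι κ : Type} [Fintype ι] [DecidableEq ι] [Fintype κ] [DecidableEq κ]
    (e : ι ≃ κ) {ρ : Matrix ι ι ℂ} (h : ρ.IsHermitian) :
    entropy (Matrix.reindex e e ρ) = entropy ρ := by
  rw [entropy_eq_sum_roots h, entropy_eq_sum_roots (ρ := Matrix.reindex e e ρ) (h.submatrix e.symm),
    Matrix.charpoly_reindex]

theorem entropy_diagonal {ι : Type} [Fintype ι] [DecidableEq ι] (d : ι → ℝ) :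
    entropy (Matrix.diagonal fun j => (d j : ℂ)) =
      (∑ j, Real.negMulLog (d j)) / Real.log 2 := by
  have h : (Matrix.diagonal fun j => (d j : ℂ)).IsHermitian :=
    Matrix.isHermitian_diagonal_of_self_adjoint _ (by ext; simp)
  rw [entropy_eq_sum_roots h, Matrix.charpoly_diagonal, Polynomial.roots_prod _ _
    (Finset.prod_ne_zero_iff.mpr fun j _ => Polynomial.X_sub_C_ne_zero _)]
  simp [Polynomial.roots_X_sub_C, Multiset.bind_singleton]

theorem charpoly_blockDiagonal {κ γ : Type} [Fintype κ] [DecidableEq κ] [Fintype γ]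
    [DecidableEq γ] (M : γ → Matrix κ κ ℂ) :
    (Matrix.blockDiagonal M).charpoly = ∏ c, (M c).charpoly := by
  have : (Matrix.blockDiagonal M).charmatrix = Matrix.blockDiagonal fun c => (M c).charmatrix := by
    ext ⟨a, c⟩ ⟨a', c'⟩ : 1
    by_cases hc : c = c'
    · subst hc
      by_cases ha : a = a' <;>
        simp [Matrix.blockDiagonal_apply, ha]
    · simp [Matrix.blockDiagonal_apply, hc]
  rw [Matrix.charpoly, this, Matrix.det_blockDiagonal]
  rfl

theorem entropy_blockDiagonal {κ γ : Type} [Fintype κ] [DecidableEq κ] [Fintype γ]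
    [DecidableEq γ] {M : γ → Matrix κ κ ℂ} (h : ∀ c, (M c).IsHermitian) :
    entropy (Matrix.blockDiagonal M) = ∑ c, entropy (M c) := by
  have hM : (Matrix.blockDiagonal M).IsHermitian := by
    rw [Matrix.IsHermitian, Matrix.blockDiagonal_conjTranspose]
    exact congrArg _ (funext h)
  rw [entropy_eq_sum_roots hM, charpoly_blockDiagonal, Polynomial.roots_prod]
  · rw [Multiset.map_bind, Multiset.sum_bind]
    simp only [fun c => entropy_eq_sum_roots (h c), ← Finset.sum_div]
    rfl
  · exact Finset.prod_ne_zero_iff.mpr fun c _ => (Matrix.charpoly_monic _).ne_zero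

theorem entropy_mul_log_two {ι : Type} [Fintype ι] [DecidableEq ι] {ρ : Matrix ι ι ℂ}
    (h : ρ.IsHermitian) :
    entropy ρ * Real.log 2 = ∑ j, Real.negMulLog (h.eigenvalues j) := by
  rw [entropy, dif_pos h, div_mul_cancel₀ _ (Real.log_pos one_lt_two).ne']

theorem sum_eigenvalues_eq_re_trace {ι : Type} [Fintype ι] [DecidableEq ι] {ρ : Matrix ι ι ℂ}
    (h : ρ.IsHermitian) : ∑ j, h.eigenvalues j = ρ.trace.re := by
  rw [h.trace_eq_sum_eigenvalues]
  simp

theorem negMulLog_trace_le_entropy {ι : Type} [Fintype ι] [DecidableEq ι] {ρ : Matrix ι ι ℂ}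
    (h : ρ.PosSemidef) : Real.negMulLog ρ.trace.re ≤ entropy ρ * Real.log 2 := by
  rw [entropy_mul_log_two h.1, ← sum_eigenvalues_eq_re_trace h.1]
  exact negMulLog_sum_le h.eigenvalues_nonneg

theorem entropy_le_of_trace {ι : Type} [Fintype ι] [DecidableEq ι] {ρ : Matrix ι ι ℂ}
    (h : ρ.PosSemidef) :
    entropy ρ * Real.log 2 ≤
      Real.negMulLog ρ.trace.re + ρ.trace.re * Real.log (Fintype.card ι) := by
  rw [entropy_mul_log_two h.1, ← sum_eigenvalues_eq_re_trace h.1]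
  exact sum_negMulLog_le h.eigenvalues_nonneg

/-- The entropy of a state that is classical on the register `γ` exceeds the entropy of that
register by at most the size of the remaining register `κ`. -/
theorem entropy_classical_bounds {ι κ γ : Type} [Fintype ι] [DecidableEq ι] [Fintype κ]
    [DecidableEq κ] [Fintype γ] [DecidableEq γ] (e : ι ≃ κ × γ) {ρ : Matrix ι ι ℂ}
    (h : ρ.PosSemidef) (hρ : ∀ s t, (e s).2 ≠ (e t).2 → ρ s t = 0) {p : γ → ℝ}
    (hp : ∀ c, (∑ a, ρ (e.symm (a, c)) (e.symm (a, c))).re = p c) :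
    ∑ c, Real.negMulLog (p c) ≤ entropy ρ * Real.log 2 ∧
      entropy ρ * Real.log 2 ≤
        ∑ c, Real.negMulLog (p c) + (∑ c, p c) * Real.log (Fintype.card κ) := by
  -- The unnormalised conditional states: block `c` has trace `p c`.
  set M : γ → Matrix κ κ ℂ := fun c => ρ.submatrix (fun a => e.symm (a, c))
    (fun a => e.symm (a, c)) with hM
  have hpos : ∀ c, (M c).PosSemidef := fun c => h.submatrix _
  have htr : ∀ c, (M c).trace.re = p c := fun c => hp c
  have heq : Matrix.reindex e e ρ = Matrix.blockDiagonal M := by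
    ext ⟨a, c⟩ ⟨a', c'⟩
    by_cases hc : c = c'
    · subst hc
      simp [hM, Matrix.blockDiagonal_apply]
    · simpa [Matrix.blockDiagonal_apply, hc] using hρ _ _ (by simpa using hc)
  rw [← entropy_reindex e h.1, heq, entropy_blockDiagonal fun c => (hpos c).1, Finset.sum_mul,
    Finset.sum_mul, ← Finset.sum_add_distrib]
  constructor
  · exact Finset.sum_le_sum fun c _ => by rw [← htr]; exact negMulLog_trace_le_entropy (hpos c)
  · exact Finset.sum_le_sum fun c _ => by rw [← htr]; exact entropy_le_of_trace (hpos c)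

/-! ### Reduced states -/

theorem reducedState_posSemidef {ι κ τ : Type} [Fintype τ] (e : ι ≃ κ × τ)
    {ρ : Matrix ι ι ℂ} (h : ρ.PosSemidef) : (reducedState e ρ).PosSemidef := by
  have : reducedState e ρ =
      ∑ t, ρ.submatrix (fun a => e.symm (a, t)) (fun a => e.symm (a, t)) := by
    ext a a'
    simp [reducedState, Matrix.sum_apply]
  rw [this]
  exact Matrix.posSemidef_sum _ fun t _ => h.submatrix _

theorem trace_reducedState {ι κ τ : Type} [Fintype ι] [Fintype κ] [Fintype τ] (e : ι ≃ κ × τ)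
    (ρ : Matrix ι ι ℂ) : (reducedState e ρ).trace = ρ.trace := by
  simp only [Matrix.trace, Matrix.diag, reducedState, Matrix.of_apply]
  rw [← Fintype.sum_prod_type' (f := fun a t => ρ (e.symm (a, t)) (e.symm (a, t)))]
  exact e.symm.sum_comp fun s => ρ s s

theorem reducedState_diagonal {ι κ τ : Type} [DecidableEq ι] [DecidableEq κ] [Fintype τ]
    (e : ι ≃ κ × τ) (d : ι → ℝ) :
    reducedState e (Matrix.diagonal fun j => (d j : ℂ)) =
      Matrix.diagonal fun a => ((∑ t, d (e.symm (a, t)) : ℝ) : ℂ) := by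
  ext a a'
  by_cases h : a = a'
  · subst h; simp [reducedState]
  · simp [reducedState, Matrix.diagonal_apply, h]

/-! ### Conditional mutual information -/

/-- A register that is classical and independent of the others carries no information. -/
theorem condMutualInfo_diagonal_mul {P Q R : Type} [Fintype P] [DecidableEq P] [Fintype Q]
    [DecidableEq Q] [Fintype R] [DecidableEq R] {s : P → ℝ} {ν : Q × R → ℝ}
    (hs : ∑ a, s a = 1) (hν : ∑ b, ν b = 1) :
    condMutualInfo (Matrix.diagonal fun j : P × Q × R => ((s j.1 * ν j.2 : ℝ) : ℂ)) = 0 := by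
  have h1 : ∑ r : R, ∑ q : Q, ν (q, r) = 1 := by
    rw [Finset.sum_comm, ← hν, Fintype.sum_prod_type]
  have h2 : ∀ r : R, ∑ x : P × Q, s x.1 * ν (x.2, r) = ∑ q, ν (q, r) := by
    intro r
    rw [Fintype.sum_prod_type]
    simp only [← Finset.mul_sum, ← Finset.sum_mul, hs, one_mul]
  simp only [condMutualInfo, reducedState_diagonal, entropy_diagonal]
  simp only [Equiv.coe_fn_symm_mk, Equiv.prodComm_symm, Equiv.prodComm_apply, Prod.swap_prod_mk,
    h2,
    ← Finset.mul_sum, ← Finset.sum_mul, hs, one_mul]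
  -- Both `S(PQR)` and `S(PR)` split off the same entropy of `s`, and everything cancels.
  rw [sum_negMulLog_mul s ν, sum_negMulLog_mul s (fun r => ∑ q, ν (q, r))]
  rw [h1, hs, hν]
  ring

/-- The information that a quantum register `P` and side information `R × S` give about a
classical register `Q`, where `R` is classical, is bounded by the sizes of `P`, `R` and `S`. -/
theorem condMutualInfo_classical_le {P Q R S : Type} [Fintype P] [DecidableEq P] [Fintype Q]
    [DecidableEq Q] [Fintype R] [DecidableEq R] [Fintype S] [DecidableEq S]
    {ρ : Matrix (P × Q × (R × S)) (P × Q × (R × S)) ℂ} (h : ρ.PosSemidef) (htr : ρ.trace = 1)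
    (hρ : ∀ s t, (s.2.1, s.2.2.1) ≠ (t.2.1, t.2.2.1) → ρ s t = 0) :
    condMutualInfo ρ * Real.log 2 ≤ Real.log (Fintype.card (P × R × S)) +
      Real.log (Fintype.card S) := by
  have hPR := entropy_le_of_trace (reducedState_posSemidef
      (⟨fun s => ((s.1, s.2.2), s.2.1), fun s => (s.1.1, s.2, s.1.2),
        fun _ => rfl, fun _ => rfl⟩ : P × Q × (R × S) ≃ (P × (R × S)) × Q) h)
  have hR := negMulLog_trace_le_entropy (reducedState_posSemidef
      (⟨fun s => (s.2.2, (s.1, s.2.1)), fun s => (s.2.1, s.2.2, s.1),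
        fun _ => rfl, fun _ => rfl⟩ : P × Q × (R × S) ≃ (R × S) × (P × Q)) h)
  rw [trace_reducedState, htr] at hPR hR
  simp only [Complex.one_re, Real.negMulLog_one, zero_add, one_mul] at hPR hR
  -- The joint distribution of the classical registers. Its entropy bounds `S(QRS)` from above up to
  -- `log |S|` and `S(PQRS)` from below, so it cancels and the size of `Q` never enters.
  let p : Q × R → ℝ := fun c => (∑ a : P × S, ρ (a.1, c.1, c.2, a.2) (a.1, c.1, c.2, a.2)).re
  have hQR := (entropy_classical_bounds (p := p)
    (⟨fun s => (s.2.2, (s.1, s.2.1)), fun s => (s.2.1, s.2.2, s.1),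
      fun _ => rfl, fun _ => rfl⟩ : Q × (R × S) ≃ S × (Q × R))
    (reducedState_posSemidef (Equiv.prodComm P (Q × (R × S))) h)
    (fun s t hst => Finset.sum_eq_zero fun a _ => hρ _ _ hst)
    (fun c => by
      simp only [p, reducedState, Matrix.of_apply, Equiv.coe_fn_symm_mk, Equiv.prodComm_symm,
        Equiv.prodComm_apply, Prod.swap_prod_mk, Fintype.sum_prod_type]
      rw [Finset.sum_comm])).2
  have hall := (entropy_classical_bounds (p := p)
    (⟨fun s => ((s.1, s.2.2.2), (s.2.1, s.2.2.1)), fun s => (s.1.1, s.2.1, s.2.2, s.1.2),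
      fun _ => rfl, fun _ => rfl⟩ : P × Q × (R × S) ≃ (P × S) × (Q × R))
    h (fun s t hst => hρ _ _ hst) (fun c => rfl)).1
  have hsum : ∑ c, p c = 1 := by
    have h1 : (∑ c : Q × R, ∑ a : P × S, ρ (a.1, c.1, c.2, a.2) (a.1, c.1, c.2, a.2)) = 1 := by
      rw [← htr, Matrix.trace, ← Fintype.sum_prod_type'
        (f := fun (c : Q × R) (a : P × S) => ρ (a.1, c.1, c.2, a.2) (a.1, c.1, c.2, a.2))]
      exact (⟨fun s => (s.2.1, s.1.1, s.1.2, s.2.2), fun s => ((s.2.1, s.2.2.1), (s.1, s.2.2.2)),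
        fun _ => rfl, fun _ => rfl⟩ : (Q × R) × (P × S) ≃ P × Q × (R × S)).sum_comp
          fun s => ρ s s
    simp only [p, ← Complex.re_sum, h1, Complex.one_re]
  rw [hsum, one_mul] at hQR
  rw [condMutualInfo, sub_mul, sub_mul, add_mul]
  linarith

/-! ### Unitaries -/

/-- The unitary that permutes the computational basis. -/
noncomputable def permUnitary {ι : Type} [Fintype ι] [DecidableEq ι] (σ : Equiv.Perm ι) :
    Matrix.unitaryGroup ι ℂ :=
  ⟨σ.symm.toPEquiv.toMatrix, by
    have h : (σ.symm.toPEquiv.toMatrix : Matrix ι ι ℂ)ᴴ = σ.toPEquiv.toMatrix := by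
      ext i j
      have hij : j = σ i ↔ i = σ.symm j := by rw [Equiv.eq_symm_apply, eq_comm]
      simp [PEquiv.toMatrix_apply, Equiv.toPEquiv_apply, eq_comm, apply_ite star, hij]
    rw [Matrix.mem_unitaryGroup_iff, Matrix.star_eq_conjTranspose, h, ← PEquiv.toMatrix_trans,
      ← Equiv.toPEquiv_trans, Equiv.symm_trans_self, Equiv.toPEquiv_refl, PEquiv.toMatrix_refl]⟩

theorem permUnitary_mulVec {ι : Type} [Fintype ι] [DecidableEq ι] (σ : Equiv.Perm ι)
    (v : ι → ℂ) : (permUnitary σ : Matrix ι ι ℂ) *ᵥ v = v ∘ σ.symm :=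
  PEquiv.toMatrix_toPEquiv_mulVec _ _

/-- Extend `v` to an orthonormal basis with `v` at position `i`, and take the basis vectors as
columns. -/
theorem exists_unitary_mulVec_single {ι : Type} [Fintype ι] [DecidableEq ι] (i : ι) {v : ι → ℂ}
    (hv : ∑ j, ‖v j‖ ^ 2 = 1) :
    ∃ U : Matrix.unitaryGroup ι ℂ, (U : Matrix ι ι ℂ) *ᵥ Pi.single i 1 = v := by
  have hnorm : ‖WithLp.toLp 2 v‖ = 1 := by
    rw [EuclideanSpace.norm_eq, Real.sqrt_eq_one]
    exact hv
  have ho : Orthonormal ℂ (({i} : Set ι).domRestrict fun _ => WithLp.toLp 2 v) :=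
    ⟨fun _ => hnorm, fun a b hab => (hab (Subsingleton.elim a b)).elim⟩
  obtain ⟨b, hb⟩ := ho.exists_orthonormalBasis_extension_of_card_eq (by simp)
  refine ⟨⟨(EuclideanSpace.basisFun ι ℂ).toBasis.toMatrix b,
    (EuclideanSpace.basisFun ι ℂ).toMatrix_orthonormalBasis_mem_unitary b⟩, ?_⟩
  ext j
  simp [Module.Basis.toMatrix_apply, hb i rfl]

open Classical in
/-- A unitary that prepares a given unit vector from a given vector of the computational basis. -/
noncomputable def prepUnitary {ι : Type} [Fintype ι] [DecidableEq ι] (i : ι) (v : ι → ℂ) :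
    Matrix.unitaryGroup ι ℂ :=
  if h : ∃ U : Matrix.unitaryGroup ι ℂ, (U : Matrix ι ι ℂ) *ᵥ Pi.single i 1 = v
  then h.choose else 1

theorem prepUnitary_mulVec {ι : Type} [Fintype ι] [DecidableEq ι] (i : ι) {v : ι → ℂ}
    (hv : ∑ j, ‖v j‖ ^ 2 = 1) : (prepUnitary i v : Matrix ι ι ℂ) *ᵥ Pi.single i 1 = v := by
  rw [prepUnitary, dif_pos (exists_unitary_mulVec_single i hv)]
  exact (exists_unitary_mulVec_single i hv).choose_spec

/-! ### Uniform superpositions -/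

/-- The uniform superposition of the basis vectors `f r`, for `r` in `R`. -/
noncomputable def uniformKet {R ι : Type} [Fintype R] [DecidableEq ι] (f : R → ι) : ι → ℂ :=
  fun s => ((√(Fintype.card R))⁻¹ : ℝ) * ∑ r, if f r = s then 1 else 0

section UniformKet

variable {R ι : Type} [Fintype R]

theorem inv_sqrt_card_mul_self :
    (((√(Fintype.card R))⁻¹ : ℝ) : ℂ) * ((√(Fintype.card R))⁻¹ : ℝ) =
      ((Fintype.card R : ℝ)⁻¹ : ℝ) := by
  rw [← Complex.ofReal_mul, ← mul_inv, Real.mul_self_sqrt (Nat.cast_nonneg _)]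

theorem uniformKet_eq_zero [DecidableEq ι] {f : R → ι} {s : ι} (h : ∀ r, f r ≠ s) :
    uniformKet f s = 0 := by
  simp [uniformKet, h]

/-- The reduced state of a uniform superposition, when the part that is traced out determines the
branch. -/
theorem sum_uniformKet_mul_star {α β : Type} [Fintype α] [DecidableEq α] [DecidableEq β]
    {f : R → α × β} (hf : Function.Injective fun r => (f r).1) (b b' : β) :
    ∑ a, uniformKet f (a, b) * star (uniformKet f (a, b')) =
      if b = b' then
        (((Fintype.card R : ℝ)⁻¹ * ∑ r, if (f r).2 = b then (1 : ℝ) else 0 : ℝ) : ℂ) else 0 := by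
  classical
  -- Cross terms between distinct branches vanish, because the traced-out part tells the branches
  -- apart.
  have key : ∀ a r r', ((if f r = (a, b) then 1 else 0) * (if f r' = (a, b') then 1 else 0) : ℂ) =
      if r = r' then if (f r).1 = a then if (f r).2 = b ∧ b = b' then 1 else 0 else 0 else 0 := by
    intro a r r'
    by_cases hr : r = r'
    · subst hr
      simp only [Prod.ext_iff]
      split_ifs <;> simp_all
    · have : ¬ ((f r).1 = a ∧ (f r').1 = a) := fun h => hr (hf (h.1.trans h.2.symm))
      simp only [Prod.ext_iff, hr]
      split_ifs <;> simp_all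
  have h1 : ∀ a, uniformKet f (a, b) * star (uniformKet f (a, b')) =
      ((Fintype.card R : ℝ)⁻¹ : ℝ) * ∑ r, ∑ r',
        ((if f r = (a, b) then 1 else 0) * (if f r' = (a, b') then 1 else 0) : ℂ) := by
    intro a
    rw [← inv_sqrt_card_mul_self, ← Finset.sum_mul_sum]
    simp only [uniformKet, star_mul', star_sum, apply_ite star, star_one, star_zero,
      Complex.star_def, Complex.conj_ofReal]
    ring
  simp only [h1, key, Finset.sum_ite_eq, Finset.mem_univ, if_true, ← Finset.mul_sum]
  rw [Finset.sum_comm]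
  simp only [Finset.sum_ite_eq, Finset.mem_univ, if_true]
  by_cases hb : b = b' <;> simp [hb]

/-- The previous lemma with a one-point register kept and everything else traced out. -/
theorem sum_normSq_uniformKet [Fintype ι] [DecidableEq ι] [Nonempty R] {f : R → ι}
    (hf : Function.Injective f) : ∑ s, ‖uniformKet f s‖ ^ 2 = 1 := by
  have h := sum_uniformKet_mul_star (f := fun r => (f r, ())) hf () ()
  have h1 : ∀ s, uniformKet (fun r => (f r, ())) (s, ()) = uniformKet f s := by
    intro s; simp [uniformKet]
  simp only [h1, Complex.star_def, Complex.mul_conj', if_true, Finset.sum_const, Finset.card_univ,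
    nsmul_eq_mul, mul_one] at h
  rw [inv_mul_cancel₀ (by simp)] at h
  exact_mod_cast h

end UniformKet

/-! ### General bounds on protocols -/

namespace Protocol

variable {X Y Z : Type}

theorem applyAlice_permUnitary {R : Type} [Fintype R] (π : Protocol X Y Z)
    (σ : Equiv.Perm (π.RegA × π.RegM)) (g : R → π.RegA × π.RegM) (b : R → π.RegB) :
    π.applyAlice (permUnitary σ) (uniformKet fun r => ((g r).1, (g r).2, b r)) =
      uniformKet fun r => ((σ (g r)).1, (σ (g r)).2, b r) := by
  ext ⟨a, m, c⟩
  have : ∀ r, ((g r).1, (g r).2, b r) = ((σ.symm (a, m)).1, (σ.symm (a, m)).2, c) ↔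
      ((σ (g r)).1, (σ (g r)).2, b r) = (a, m, c) := by
    intro r
    have h : g r = σ.symm (a, m) ↔ σ (g r) = (a, m) := Equiv.eq_symm_apply σ
    simp only [Prod.ext_iff] at h ⊢
    tauto
  simp only [applyAlice, permUnitary_mulVec, Function.comp, uniformKet, this]

theorem applyBob_permUnitary {R : Type} [Fintype R] (π : Protocol X Y Z)
    (τ : Equiv.Perm (π.RegM × π.RegB)) (f : R → π.RegA × π.RegM × π.RegB) :
    π.applyBob (permUnitary τ) (uniformKet f) = uniformKet fun r => ((f r).1, τ (f r).2) := by
  ext ⟨a, s⟩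
  have : ∀ r, f r = (a, τ.symm s) ↔ ((f r).1, τ (f r).2) = (a, s) := by
    intro r
    simp only [Prod.ext_iff (x := f r), Prod.mk.injEq, Equiv.eq_symm_apply]
  simp only [applyBob, permUnitary_mulVec, Function.comp, uniformKet, this]

theorem applyAlice_one (π : Protocol X Y Z) (φ : π.Ket) : π.applyAlice 1 φ = φ := by
  ext s
  simp [applyAlice]

theorem jointState_posSemidef [Fintype X] [DecidableEq X] [Fintype Y] [DecidableEq Y]
    (π : Protocol X Y Z) {μ : X × Y → ℝ} (hμ : ∀ p, 0 ≤ μ p) (k : ℕ) :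
    (π.jointState μ k).PosSemidef := by
  -- Positivity comes from writing the joint state as a nonnegative combination of rank-one
  -- operators, one for each input pair.
  let v : X × Y → X × Y × π.RegA × π.RegM × π.RegB → ℂ := fun p s =>
    if s.1 = p.1 ∧ s.2.1 = p.2 then π.state p.1 p.2 k s.2.2 else 0
  have : π.jointState μ k = ∑ p, (μ p : ℂ) • Matrix.vecMulVec (v p) (star (v p)) := by
    ext ⟨x, y, s⟩ ⟨x', y', t⟩
    simp only [jointState, Matrix.of_apply, Matrix.sum_apply, Matrix.smul_apply,
      Matrix.vecMulVec_apply, Pi.star_apply, smul_eq_mul]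
    rw [Fintype.sum_eq_single (x, y)]
    · by_cases h : x = x' ∧ y = y'
      · obtain ⟨rfl, rfl⟩ := h
        simp [v, mul_assoc]
      · have h' : ¬ (x' = x ∧ y' = y) := fun h' => h ⟨h'.1.symm, h'.2.symm⟩
        simp [v, h, h']
    · intro p hp
      have : ¬ (x = p.1 ∧ y = p.2) := fun h => hp (Prod.ext h.1.symm h.2.symm)
      simp [v, this]
  rw [this]
  refine Matrix.posSemidef_sum _ fun p _ => (Matrix.posSemidef_vecMulVec_self_star _).smul ?_
  exact_mod_cast hμ p

theorem jointState_trace [Fintype X] [DecidableEq X] [Fintype Y] [DecidableEq Y]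
    (π : Protocol X Y Z) {μ : X × Y → ℝ} (hμ : ∑ p, μ p = 1) {k : ℕ}
    (hk : ∀ x y, ∑ s, ‖π.state x y k s‖ ^ 2 = 1) : (π.jointState μ k).trace = 1 := by
  have h : ∀ x y, ∑ s, (μ (x, y) : ℂ) * π.state x y k s * star (π.state x y k s) = μ (x, y) := by
    intro x y
    simp only [mul_assoc, ← Finset.mul_sum, Complex.star_def, Complex.mul_conj']
    have := congrArg (fun r : ℝ => (r : ℂ)) (hk x y)
    push_cast at this
    rw [this, mul_one]
  rw [Matrix.trace, Fintype.sum_prod_type]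
  simp only [Fintype.sum_prod_type (α₁ := Y), Matrix.diag, jointState, Matrix.of_apply, and_self,
    if_true, h]
  rw [← Fintype.sum_prod_type']
  exact_mod_cast hμ

/-- Bob's privacy loss is bounded by the number of rounds and the sizes of Alice's registers and of
her input. -/
theorem lossB_le [Fintype X] [DecidableEq X] [Nonempty X] [Fintype Y] [DecidableEq Y]
    (π : Protocol X Y Z) {μ : X × Y → ℝ} (hμ : μ ∈ stdSimplex ℝ (X × Y))
    (hk : ∀ x y, ∀ k, 1 ≤ k → ∑ s, ‖π.state x y k s‖ ^ 2 = 1) :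
    π.lossB μ ≤
      π.rounds * (π.qubitsM + 2 * π.qubitsA + Real.logb 2 (Fintype.card X)) := by
  have hX : (0 : ℝ) < Fintype.card X := by exact_mod_cast Fintype.card_pos
  have hX1 : (1 : ℝ) ≤ Fintype.card X := by exact_mod_cast Fintype.card_pos (α := X)
  have hlog : (0 : ℝ) ≤ Real.logb 2 (Fintype.card X) := Real.logb_nonneg one_lt_two hX1
  refine (Finset.sum_le_card_nsmul _ _
    (π.qubitsM + 2 * π.qubitsA + Real.logb 2 (Fintype.card X)) fun k hk' => ?_).trans ?_
  · simp only [Finset.mem_filter, Finset.mem_Icc] at hk'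
    have h2 := Real.log_pos one_lt_two
    -- Here `Q` is Bob's input and the side information is Alice's classical input together with the
    -- quantum register `A`. The latter is counted twice.
    have := condMutualInfo_classical_le (reducedState_posSemidef
      (⟨fun s => ((s.2.2.2.1, s.2.1, (s.1, s.2.2.1)), s.2.2.2.2),
        fun s => (s.1.2.2.1, s.1.2.1, s.1.2.2.2, s.1.1, s.2),
        fun _ => rfl, fun _ => rfl⟩ :
        X × Y × π.RegA × π.RegM × π.RegB ≃ (π.RegM × Y × (X × π.RegA)) × π.RegB)
      (π.jointState_posSemidef hμ.1 k))
      (by rw [trace_reducedState, π.jointState_trace hμ.2 fun x y => hk x y k hk'.1.1])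
      (fun s t hst => Finset.sum_eq_zero fun b _ => if_neg fun h =>
        hst (Prod.ext h.2 h.1))
    rw [← mul_le_mul_iff_left₀ h2]
    refine this.trans (le_of_eq ?_)
    simp only [Fintype.card_prod, Fintype.card_fun, Fintype.card_bool, Fintype.card_fin,
      Nat.cast_mul, Nat.cast_pow, Nat.cast_ofNat]
    rw [Real.log_mul (by positivity) (by positivity), Real.log_mul (by positivity) (by positivity),
      Real.log_pow, Real.log_pow, Real.logb]
    field_simp
    ring
  · rw [nsmul_eq_mul]
    refine mul_le_mul_of_nonneg_right ?_ (by positivity)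
    have := (Finset.card_filter_le (Finset.Icc 1 π.rounds) fun k => Even k)
    rw [Nat.card_Icc, Nat.add_sub_cancel] at this
    exact_mod_cast this

end Protocol

/-! ### Protocols that permute basis vectors -/

/-- Alice leaks nothing if Bob has no workspace and the message in transit is in a classical state
that does not depend on the inputs. -/
theorem Protocol.lossA_eq_zero {X Y Z : Type} [Fintype X] [DecidableEq X] [Fintype Y]
    [DecidableEq Y] (π : Protocol X Y Z) [Unique π.RegB] {μ : X × Y → ℝ}
    (hμ : μ ∈ stdSimplex ℝ (X × Y))
    (h : ∀ k, 1 ≤ k → k ≤ π.rounds → Odd k → ∃ s : π.RegM → ℝ, ∑ w, s w = 1 ∧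
      ∀ x y b w w', ∑ a, π.state x y k (a, w, b) * star (π.state x y k (a, w', b)) =
        if w = w' then (s w : ℂ) else 0) : π.lossA μ = 0 := by
  refine Finset.sum_eq_zero fun k hk => ?_
  simp only [Finset.mem_filter, Finset.mem_Icc] at hk
  obtain ⟨s, hs, hk⟩ := h k hk.1.1 hk.1.2 hk.2
  have hν : ∑ q : X × (Y × π.RegB), μ (q.1, q.2.1) = 1 := by
    rw [← hμ.2, Fintype.sum_prod_type, Fintype.sum_prod_type]
    simp [Fintype.sum_prod_type]
  -- Replacing `0` by the information of a product state reduces the goal to an equality of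
  -- matrices.
  rw [← condMutualInfo_diagonal_mul hs hν]
  congr 1
  ext ⟨w, x, y, b⟩ ⟨w', x', y', b'⟩
  obtain rfl : b = b' := Subsingleton.elim _ _
  simp only [reducedState, Protocol.jointState, Matrix.of_apply, Equiv.coe_fn_symm_mk,
    Matrix.diagonal_apply, Prod.mk.injEq, and_true]
  by_cases hxy : x = x' ∧ y = y'
  · obtain ⟨rfl, rfl⟩ := hxy
    simp only [and_self, if_true, mul_assoc, ← Finset.mul_sum, hk, and_true]
    by_cases hw : w = w' <;> simp [hw, mul_comm]
  · simp only [hxy, if_false, Finset.sum_const_zero, and_false]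

section CoinProtocol

variable {X Y Z R : Type} [Fintype R] {a m : ℕ}

/-- The protocol in which Alice prepares a uniform superposition of basis vectors, after which both
players permute the basis vectors, Alice applying `σ j` in round `2 * j + 1`. -/
noncomputable abbrev coinProtocol (N : ℕ) (init : X → R → Bits a × Bits m)
    (σ : ℕ → Equiv.Perm (Bits a × Bits m)) (τ : Y → Equiv.Perm (Bits m))
    (out : Bits a × Bits m → Z) : Protocol X Y Z where
  qubitsA := a
  qubitsM := m
  qubitsB := 0
  rounds := 2 * N
  rounds_even := even_two_mul N
  aliceOp k x :=
    if k = 1 then prepUnitary (fun _ => false, fun _ => false) (uniformKet (init x))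
    else permUnitary (σ (k / 2))
  bobOp _ y := permUnitary ((τ y).prodCongr (Equiv.refl _))
  aliceFinal _ := 1
  output _ := out

/-- The basis vector of Alice's registers at round `k + 1` in one branch of the superposition. -/
def coinRun (s : Bits a × Bits m) (σ : ℕ → Equiv.Perm (Bits a × Bits m))
    (τ : Equiv.Perm (Bits m)) : ℕ → Bits a × Bits m
  | 0 => s
  | k + 1 =>
    if Even k then ((coinRun s σ τ k).1, τ (coinRun s σ τ k).2)
    else σ ((k + 1) / 2) (coinRun s σ τ k)

theorem coinRun_injective (σ : ℕ → Equiv.Perm (Bits a × Bits m)) (τ : Equiv.Perm (Bits m))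
    (k : ℕ) : Function.Injective fun s => coinRun s σ τ k := by
  induction k with
  | zero => exact fun _ _ h => h
  | succ k ih =>
    intro s t h
    apply ih
    by_cases hk : Even k
    · simpa [coinRun, hk, Prod.ext_iff] using h
    · simpa [coinRun, hk] using h

variable {N : ℕ} {init : X → R → Bits a × Bits m} {σ : ℕ → Equiv.Perm (Bits a × Bits m)}
  {τ : Y → Equiv.Perm (Bits m)} {out : Bits a × Bits m → Z}

theorem uniformKet_trivial_register (g : R → Bits a × Bits m) (u : Bits a) (w : Bits m)
    (b : Bits 0) :
    uniformKet (ι := Bits a × Bits m × Bits 0) (fun r => ((g r).1, (g r).2, fun _ => false))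
      (u, w, b) = uniformKet g (u, w) := by
  have hb : (fun _ => false : Bits 0) = b := Subsingleton.elim _ _
  simp only [uniformKet, Prod.ext_iff, hb, and_true]

/-- Permutations carry a uniform superposition to that of the image vectors. The shift by one
accounts for round `1`, which prepares the superposition; step `k` of `coinRun` produces round `k +
2`, so Bob acts when `k` is even. -/
theorem coinProtocol_state [Nonempty R] (hinit : ∀ x, Function.Injective (init x)) (x : X) (y : Y)
    (k : ℕ) : (coinProtocol N init σ τ out).state x y (k + 1) =
      uniformKet (ι := Bits a × Bits m × Bits 0) fun r =>
        ((coinRun (init x r) σ (τ y) k).1, (coinRun (init x r) σ (τ y) k).2, fun _ => false) := by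
  induction k with
  | zero =>
    ext ⟨u, w, b⟩
    have hb : (fun _ => false : Bits 0) = b := Subsingleton.elim _ _
    have h0 : (fun p : Bits a × Bits m => (Pi.single ((fun _ => false), (fun _ => false),
        (fun _ => false)) 1 : Bits a × Bits m × Bits 0 → ℂ) (p.1, p.2, b)) =
        Pi.single (fun _ => false, fun _ => false) 1 := by
      ext p
      simp only [Pi.single_apply, Prod.ext_iff, hb, and_true]
    have h1 : (coinProtocol N init σ τ out).state x y (0 + 1) (u, w, b) =
        ((prepUnitary (fun _ => false, fun _ => false) (uniformKet (init x)) :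
          Matrix.unitaryGroup (Bits a × Bits m) ℂ).1 *ᵥ
          Pi.single (fun _ => false, fun _ => false) 1) (u, w) := by
      rw [← h0]
      rfl
    rw [h1, prepUnitary_mulVec _ (sum_normSq_uniformKet (hinit x))]
    exact (uniformKet_trivial_register (init x) u w b).symm
  | succ k ih =>
    by_cases hk : Even k
    · have hodd : ¬ Odd (k + 1 + 1) := by
        rw [Nat.not_odd_iff_even]; exact hk.add_one.add_one
      rw [Protocol.state, if_neg hodd, ih]
      refine (Protocol.applyBob_permUnitary (coinProtocol N init σ τ out) _ _).trans ?_
      simp only [coinRun, if_pos hk]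
      rfl
    · have hodd : Odd (k + 1 + 1) := (Nat.not_even_iff_odd.mp hk).add_one.add_one
      have hop : (coinProtocol N init σ τ out).aliceOp (k + 1 + 1) x =
          permUnitary (σ ((k + 1) / 2)) := by
        have h2 : (k + 1 + 1) / 2 = (k + 1) / 2 := by
          obtain ⟨l, rfl⟩ := Nat.not_even_iff_odd.mp hk
          omega
        simp [h2]
      rw [Protocol.state, if_pos hodd, ih, hop]
      refine (Protocol.applyAlice_permUnitary (coinProtocol N init σ τ out) _ _ _).trans ?_
      simp only [coinRun, if_neg hk]

theorem coinProtocol_sum_normSq [Nonempty R] (hinit : ∀ x, Function.Injective (init x)) (x : X)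
    (y : Y) (k : ℕ) (hk : 1 ≤ k) :
    ∑ s, ‖(coinProtocol N init σ τ out).state x y k s‖ ^ 2 = 1 := by
  obtain ⟨k, rfl⟩ := Nat.exists_eq_add_of_le' hk
  rw [coinProtocol_state hinit]
  refine sum_normSq_uniformKet fun r r' h => hinit x (coinRun_injective σ (τ y) k ?_)
  simp only [Prod.mk.injEq, and_true] at h
  exact Prod.ext h.1 h.2

/-- Every branch yields the right output, so wrong outputs have amplitude zero and the success
probability is the whole squared norm. -/
theorem coinProtocol_computes [DecidableEq Z] [Nonempty R]
    (hinit : ∀ x, Function.Injective (init x)) (hN : 0 < N) {f : X → Y → Z}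
    (hf : ∀ x y r, out (coinRun (init x r) σ (τ y) (2 * N - 1)) = f x y) :
    (coinProtocol N init σ τ out).Computes f := by
  intro x y
  have h1 : (coinProtocol N init σ τ out).rounds = 2 * N - 1 + 1 := by
    change 2 * N = _
    omega
  rw [← coinProtocol_sum_normSq (N := N) (σ := σ) (τ := τ) (out := out) hinit x y _
    (Nat.le_add_left 1 (2 * N - 1)), Protocol.outputProb, h1]
  refine Finset.sum_congr rfl fun s _ => ?_
  rw [show (coinProtocol N init σ τ out).aliceFinal x = 1 from rfl, Protocol.applyAlice_one]
  split_ifs with h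
  · rfl
  · have h0 : (coinProtocol N init σ τ out).state x y (2 * N - 1 + 1) s = 0 := by
      rw [coinProtocol_state hinit]
      refine uniformKet_eq_zero ?_
      rintro r rfl
      exact h (hf x y r)
    rw [h0, norm_zero, zero_pow two_ne_zero]

/-- By `hA` Alice's memory determines the coins, so the message state is diagonal; by `hM` its
diagonal is the same for all inputs. -/
theorem coinProtocol_lossA_eq_zero [Fintype X] [DecidableEq X] [Fintype Y] [DecidableEq Y]
    [Nonempty R] (hinit : ∀ x, Function.Injective (init x)) {μ : X × Y → ℝ}
    (hμ : μ ∈ stdSimplex ℝ (X × Y))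
    (hA : ∀ j < N, ∀ x y, Function.Injective fun r => (coinRun (init x r) σ (τ y) (2 * j)).1)
    (hM : ∀ j < N, ∀ x y x' y' w,
      (∑ r, if (coinRun (init x r) σ (τ y) (2 * j)).2 = w then (1 : ℝ) else 0) =
        ∑ r, if (coinRun (init x' r) σ (τ y') (2 * j)).2 = w then (1 : ℝ) else 0) :
    (coinProtocol N init σ τ out).lossA μ = 0 := by
  obtain ⟨x₀, y₀⟩ : Nonempty (X × Y) := by
    by_contra! h
    have := hμ.2
    simp at this
  have : Unique (coinProtocol N init σ τ out).RegB := inferInstanceAs (Unique (Fin 0 → Bool))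
  refine Protocol.lossA_eq_zero _ hμ fun k hk1 hk2 hodd => ?_
  obtain ⟨j, rfl⟩ := hodd
  have hj : j < N := by
    change 2 * j + 1 ≤ 2 * N at hk2
    omega
  refine ⟨fun w : Bits m => (Fintype.card R : ℝ)⁻¹ *
    ∑ r, if (coinRun (init x₀ r) σ (τ y₀) (2 * j)).2 = w then (1 : ℝ) else 0, ?_, ?_⟩
  · rw [← Finset.mul_sum, Finset.sum_comm]
    simp only [Finset.sum_ite_eq, Finset.mem_univ, if_true]
    simp
  · intro x y b w w'
    have h1 : ∀ (u : Bits a) (v : Bits m), (coinProtocol N init σ τ out).state x y (2 * j + 1) (u, v, b) =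
        uniformKet (fun r => coinRun (init x r) σ (τ y) (2 * j)) (u, v) := by
      intro u v
      rw [coinProtocol_state hinit]
      exact uniformKet_trivial_register _ u v b
    simp only [h1, hM j hj x₀ y₀ x y]
    exact sum_uniformKet_mul_star (hA j hj x y) w w'

end CoinProtocol

/-! ### Protocols that ask a sequence of queries -/

/-- Exchange the message with the slot `j` of the memory. -/
def slotSwap (α W : Type) (N j : ℕ) : Equiv.Perm ((α × (Fin N → W)) × W) :=
  if h : j < N then
    Function.Involutive.toPerm
      (fun c => ((c.1.1, Function.update c.1.2 ⟨j, h⟩ c.2), c.1.2 ⟨j, h⟩))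
      (fun c => by simp)
  else Equiv.refl _

theorem slotSwap_apply {α W : Type} {N : ℕ} (j : Fin N) (c : (α × (Fin N → W)) × W) :
    slotSwap α W N j c = ((c.1.1, Function.update c.1.2 j c.2), c.1.2 j) := by
  rw [slotSwap, dif_pos j.2]
  rfl

section AskProtocol

variable {X Y Z Q V : Type} [AddCommGroup V] {N a m : ℕ}

/-- The configuration of Alice's registers in which query `0` is in transit and the other queries
`q j` are in the memory, together with the coins `r`. -/
def askInit [Inhabited Q] (eA : Bits a ≃ Q × (Fin N → Q × V)) (eM : Bits m ≃ Q × V)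
    (q : Fin N → Q) (r : Q) : Bits a × Bits m :=
  (eA.prodCongr eM).symm
    (slotSwap Q (Q × V) N 0 ((r, fun j => (q j, 0)), (default, 0)))

/-- Alice stores the message she received and sends the query `j`. -/
def askSwap (eA : Bits a ≃ Q × (Fin N → Q × V)) (eM : Bits m ≃ Q × V) (j : ℕ) :
    Equiv.Perm (Bits a × Bits m) :=
  ((eA.prodCongr eM).trans (slotSwap Q (Q × V) N j)).trans (eA.prodCongr eM).symm

/-- Bob adds his answer to the query in the message. -/
def answerPerm (eM : Bits m ≃ Q × V) (ans : Q → V) : Equiv.Perm (Bits m) :=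
  (eM.trans (Equiv.prodShear (Equiv.refl Q) fun q => Equiv.addRight (ans q))).trans eM.symm

/-- The protocol in which Alice sends the queries `query x r j`, for `j < N`, in superposition over
all coins `r`, and Bob adds his answer to each. Alice outputs a function of the sum of all the
answers. Her memory contains the coins and the messages that are not in transit. -/
noncomputable abbrev askProtocol [Fintype Q] [Inhabited Q] (eA : Bits a ≃ Q × (Fin N → Q × V))
    (eM : Bits m ≃ Q × V) (query : X → Q → Fin N → Q) (answer : Y → Q → V) (out : V → Z) :
    Protocol X Y Z :=
  coinProtocol N (fun x r => askInit eA eM (query x r) r) (askSwap eA eM)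
    (fun y => answerPerm eM (answer y)) (fun s => out ((∑ j, ((eA s.1).2 j).2) + (eM s.2).2))

/-- When query `j` is in transit, the memory contains the coins and the queries that follow, and
the answers in it add up to the sum of the answers to the queries that precede. -/
structure AskInvariant (q : Fin N → Q) (ans : Q → V) (r : Q) (j : ℕ)
    (c : (Q × (Fin N → Q × V)) × (Q × V)) : Prop where
  coins : c.1.1 = r
  memory : ∀ l : Fin N, j < l → c.1.2 l = (q l, 0)
  message : ∀ l : Fin N, (l : ℕ) = j → c.2 = (q l, 0)
  sum_eq : ∑ l, (c.1.2 l).2 = ∑ l : Fin N, if (l : ℕ) < j then ans (q l) else 0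

theorem askInvariant_init (q : Fin N → Q) (ans : Q → V) (r : Q) (d : Q) (hN : 0 < N) :
    AskInvariant q ans r 0
      (slotSwap Q (Q × V) N 0 ((r, fun j => (q j, 0)), (d, 0))) := by
  have := slotSwap_apply (⟨0, hN⟩ : Fin N) ((r, fun j => (q j, (0 : V))), (d, (0 : V)))
  simp only at this
  rw [this]
  refine ⟨rfl, fun l hl => ?_, fun l hl => ?_, ?_⟩
  · have hl' : l ≠ ⟨0, hN⟩ := by
      rintro rfl
      simp at hl
    simp only [Function.update_of_ne hl']
  · obtain rfl : l = ⟨0, hN⟩ := Fin.ext hl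
    rfl
  · simp only [Nat.not_lt_zero, if_false, Finset.sum_const_zero]
    refine Finset.sum_eq_zero fun l _ => ?_
    by_cases h : l = ⟨0, hN⟩
    · subst h; simp
    · simp [h]

theorem sum_ite_lt_succ (g : Fin N → V) (j : Fin N) :
    (∑ l : Fin N, if (l : ℕ) < j + 1 then g l else 0) =
      (∑ l : Fin N, if (l : ℕ) < j then g l else 0) + g j := by
  have : g j = ∑ l : Fin N, if l = j then g l else 0 := by simp
  rw [this, ← Finset.sum_add_distrib]
  refine Finset.sum_congr rfl fun l _ => ?_
  rcases lt_trichotomy (l : ℕ) j with h | h | h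
  · simp [h, Nat.lt_succ_of_lt h, Fin.ext_iff, h.ne]
  · simp [Fin.ext_iff, h]
  · rw [if_neg (by omega), if_neg (by omega), if_neg (by rw [Fin.ext_iff]; omega), add_zero]

/-- Slot `j + 1` gives up query `j + 1` and receives the answered query `j`. It held the value `0`
before, so the sum over the memory grows by exactly that answer; slot `0` keeps the blank message.
-/
theorem AskInvariant.succ {q : Fin N → Q} {ans : Q → V} {r : Q} {j : ℕ} (hj : j + 1 < N)
    {c : (Q × (Fin N → Q × V)) × (Q × V)} (h : AskInvariant q ans r j c) :
    AskInvariant q ans r (j + 1)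
      (slotSwap Q (Q × V) N (j + 1) (c.1, (c.2.1, c.2.2 + ans c.2.1))) := by
  have := slotSwap_apply (⟨j + 1, hj⟩ : Fin N) (c.1, (c.2.1, c.2.2 + ans c.2.1))
  simp only at this
  rw [this]
  have hm := h.message ⟨j, by omega⟩ rfl
  have hj0 := h.memory ⟨j + 1, hj⟩ (Nat.lt_succ_self j)
  refine ⟨h.coins, fun l hl => ?_, fun l hl => ?_, ?_⟩
  · refine (Function.update_of_ne ?_ _ _).trans (h.memory l (by omega))
    rintro rfl
    simp at hl
  · obtain rfl : l = ⟨j + 1, hj⟩ := Fin.ext hl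
    exact hj0
  · have h1 : ∀ l, (Function.update c.1.2 ⟨j + 1, hj⟩ (c.2.1, c.2.2 + ans c.2.1) l).2 =
        (c.1.2 l).2 + if l = ⟨j + 1, hj⟩ then ans (q ⟨j, by omega⟩) else 0 := by
      intro l
      by_cases hl : l = ⟨j + 1, hj⟩
      · subst hl
        simp [hj0, hm]
      · simp [hl]
    simp only [h1, Finset.sum_add_distrib, h.sum_eq, Finset.sum_ite_eq', Finset.mem_univ, if_true]
    exact (sum_ite_lt_succ (fun l => ans (q l)) ⟨j, by omega⟩).symm

variable [Inhabited Q] (eA : Bits a ≃ Q × (Fin N → Q × V)) (eM : Bits m ≃ Q × V)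

theorem askInvariant_coinRun (q : Fin N → Q) (ans : Q → V) (r : Q) (j : ℕ) (hj : j < N) :
    AskInvariant q ans r j ((eA.prodCongr eM)
      (coinRun (askInit eA eM q r) (askSwap eA eM) (answerPerm eM ans) (2 * j))) := by
  induction j with
  | zero =>
    rw [Nat.mul_zero, coinRun, askInit, Equiv.apply_symm_apply]
    exact askInvariant_init _ _ _ _ hj
  | succ j ih =>
    have h := (ih (by omega)).succ hj
    have h1 : ¬ Even (2 * j + 1) := by simp
    have h2 : (2 * j + 1 + 1) / 2 = j + 1 := by omega
    rw [Nat.mul_succ, coinRun, if_neg h1, coinRun, if_pos (even_two_mul j), h2]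
    set c := coinRun (askInit eA eM q r) (askSwap eA eM) (answerPerm eM ans) (2 * j)
    have h3 : (eA.prodCongr eM) (askSwap eA eM (j + 1) (c.1, answerPerm eM ans c.2)) =
        slotSwap Q (Q × V) N (j + 1) ((eA.prodCongr eM) (c.1, answerPerm eM ans c.2)) :=
      Equiv.apply_symm_apply _ _
    have h4 : eM (answerPerm eM ans c.2) = ((eM c.2).1, (eM c.2).2 + ans (eM c.2).1) :=
      Equiv.apply_symm_apply _ _
    rw [h3, Equiv.prodCongr_apply, Prod.map_apply, h4]
    exact h

theorem askInit_injective (query : Q → Fin N → Q) :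
    Function.Injective fun r => askInit eA eM (query r) r := by
  intro r r' h
  have := (slotSwap Q (Q × V) N 0).injective ((eA.prodCongr eM).symm.injective h)
  exact congrArg (fun c => c.1.1) this

variable [Fintype Q] {query : X → Q → Fin N → Q} {answer : Y → Q → V} {out : V → Z}

/-- At the end the last answer is still in the message register and the earlier ones are in memory,
whence the two terms in the output of `askProtocol`. -/
theorem askProtocol_computes [DecidableEq Z] (hN : 0 < N) {f : X → Y → Z}
    (hf : ∀ x y r, out (∑ j, answer y (query x r j)) = f x y) :
    (askProtocol eA eM query answer out).Computes f := by
  refine coinProtocol_computes (fun x => askInit_injective eA eM (query x)) hN fun x y r => ?_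
  obtain ⟨M, rfl⟩ := Nat.exists_eq_add_of_le' hN
  have h := askInvariant_coinRun eA eM (query x r) (answer y) r M (by omega)
  have hk : 2 * (M + 1) - 1 = 2 * M + 1 := by omega
  have hm := h.message (Fin.last M) rfl
  have hsum := h.sum_eq
  rw [hk, coinRun, if_pos (even_two_mul M), ← hf x y r]
  set c := coinRun (askInit eA eM (query x r) r) (askSwap eA eM) (answerPerm eM (answer y)) (2 * M)
  have h4 : eM (answerPerm eM (answer y) c.2) =
      ((eM c.2).1, (eM c.2).2 + answer y (eM c.2).1) :=
    Equiv.apply_symm_apply _ _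
  simp only [Equiv.prodCongr_apply, Prod.map_fst, Prod.map_snd] at hm hsum
  congr 1
  simp only [h4, hsum, hm, zero_add]
  refine (sum_ite_lt_succ (fun l => answer y (query x r l)) (Fin.last M)).symm.trans ?_
  exact Finset.sum_congr rfl fun l _ => if_pos (by simpa using l.2)

/-- Bijectivity in the coins makes each query uniform, and its answer part is `0` while it travels
to Bob. -/
theorem askProtocol_lossA_eq_zero [Fintype X] [DecidableEq X] [Fintype Y] [DecidableEq Y]
    (hq : ∀ x j, Function.Bijective fun r => query x r j) {μ : X × Y → ℝ}
    (hμ : μ ∈ stdSimplex ℝ (X × Y)) : (askProtocol eA eM query answer out).lossA μ = 0 := by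
  refine coinProtocol_lossA_eq_zero (fun x => askInit_injective eA eM (query x)) hμ ?_ ?_
  · intro j hj x y r r' h
    rw [← (askInvariant_coinRun eA eM (query x r) (answer y) r j hj).coins,
      ← (askInvariant_coinRun eA eM (query x r') (answer y) r' j hj).coins]
    exact congrArg (fun u => (eA u).1) h
  · intro j hj x y x' y' w
    have key : ∀ x y, (∑ r, if (coinRun (askInit eA eM (query x r) r) (askSwap eA eM)
        (answerPerm eM (answer y)) (2 * j)).2 = w then (1 : ℝ) else 0) =
        ∑ q : Q, if eM.symm (q, 0) = w then (1 : ℝ) else 0 := by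
      intro x y
      rw [← (hq x ⟨j, hj⟩).sum_comp fun q => if eM.symm (q, 0) = w then (1 : ℝ) else 0]
      refine Finset.sum_congr rfl fun r _ => ?_
      have h := (askInvariant_coinRun eA eM (query x r) (answer y) r j hj).message ⟨j, hj⟩ rfl
      rw [← h]
      simp
    exact (key x y).trans (key x' y').symm

end AskProtocol

/-! ### Multilinear extensions over finite fields -/

section MultilinearExtension

variable {F : Type} [Field F] {n m : ℕ}

/-- The point of `F ^ m` with the given bits as coordinates. -/
def bitPoint (b : Fin m → Bool) : Fin m → F := fun l => if b l then 1 else 0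

/-- The multilinear polynomial that takes the value `x i` at the point with bits `ε i`. -/
def multilinearExt (ε : Fin n → Fin m → Bool) (x : Fin n → Bool) (z : Fin m → F) : F :=
  ∑ i, if x i then ∏ l, (if ε i l then z l else 1 - z l) else 0

theorem multilinearExt_bitPoint {ε : Fin n → Fin m → Bool} (hε : Function.Injective ε)
    (x : Fin n → Bool) (i : Fin n) :
    multilinearExt ε x (bitPoint (ε i) : Fin m → F) = if x i then 1 else 0 := by
  rw [multilinearExt, Fintype.sum_eq_single i]
  · rw [Finset.prod_eq_one]
    intro l _
    cases h : ε i l <;> simp [bitPoint, h]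
  · intro k hk
    obtain ⟨l, hl⟩ : ∃ l, ε k l ≠ ε i l := by
      by_contra! h
      exact hk (hε (funext h))
    rw [Finset.prod_eq_zero (Finset.mem_univ l), ite_self]
    cases h : ε i l <;> cases h' : ε k l <;> simp_all [bitPoint]

/-- On a line each of the `m` factors of a monomial is affine in `t`. -/
theorem exists_polynomial_multilinearExt (ε : Fin n → Fin m → Bool) (x : Fin n → Bool)
    (u r : Fin m → F) : ∃ p : Polynomial F, p.natDegree ≤ m ∧
      ∀ t, p.eval t = multilinearExt ε x fun l => u l + t * r l := by
  let L : Fin m → Polynomial F := fun l => Polynomial.C (u l) + Polynomial.X * Polynomial.C (r l)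
  have hL : ∀ l, (L l).natDegree ≤ 1 := fun l => by simp only [L]; compute_degree
  refine ⟨∑ i, if x i then ∏ l, (if ε i l then L l else 1 - L l) else 0, ?_, fun t => ?_⟩
  · refine Polynomial.natDegree_sum_le_of_forall_le _ _ fun i _ => ?_
    split_ifs
    · refine (Polynomial.natDegree_prod_le _ _).trans ?_
      refine (Finset.sum_le_card_nsmul _ _ 1 fun l _ => ?_).trans (by simp)
      split_ifs
      · exact hL l
      · exact (Polynomial.natDegree_sub_le _ _).trans (by simpa using hL l)
    · simp
  · simp only [multilinearExt, Polynomial.eval_finsetSum, apply_ite (Polynomial.eval t),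
      Polynomial.eval_prod, L, Polynomial.eval_add, Polynomial.eval_sub, Polynomial.eval_mul,
      Polynomial.eval_X, Polynomial.eval_C, Polynomial.eval_one, Polynomial.eval_zero]

theorem sum_eval_eq_zero [Fintype F] {p : Polynomial F}
    (hp : p.natDegree < Fintype.card F - 1) : ∑ t, p.eval t = 0 := by
  simp only [Polynomial.eval_eq_sum_range]
  rw [Finset.sum_comm]
  refine Finset.sum_eq_zero fun k hk => ?_
  rw [← Finset.mul_sum, FiniteField.sum_pow_lt_card_sub_one, mul_zero]
  have := Finset.mem_range.mp hk
  omega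

/-- Interpolation at `0` with all coefficients equal to `-1`, which is why Alice only needs the sum
of the answers. -/
theorem sum_ne_zero_eval_eq [Fintype F] [DecidableEq F] {p : Polynomial F}
    (hp : p.natDegree < Fintype.card F - 1) : ∑ t : {t : F // t ≠ 0}, p.eval t.1 = -p.eval 0 := by
  have h := sum_eval_eq_zero hp
  rw [← Finset.add_sum_erase _ _ (Finset.mem_univ 0)] at h
  rw [← Finset.sum_subtype (Finset.univ.erase 0) (p := fun t : F => t ≠ 0) (by simp)
    fun t => p.eval t]
  exact eq_neg_of_add_eq_zero_right h

end MultilinearExtension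

/-- A protocol for Private Information Retrieval. Alice queries the multilinear extension of the
database, over a field with `2 ^ s` elements, at the points of a random line through the point
that encodes her index. -/
theorem exists_pirProtocol {n m s : ℕ} (hn : n ≤ 2 ^ m) (hs : m + 2 ≤ 2 ^ s) :
    ∃ π : Protocol (Fin n) (Fin n → Bool) Bool,
      π.Computes (index n) ∧
      (∀ μ ∈ stdSimplex ℝ (Fin n × (Fin n → Bool)), π.lossA μ = 0) ∧
      (∀ x y k, 1 ≤ k → ∑ s, ‖π.state x y k s‖ ^ 2 = 1) ∧
      π.rounds = 2 * (2 ^ s - 1) ∧ π.qubitsM = s * m + s ∧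
      π.qubitsA = s * m + (s * m + s) * (2 ^ s - 1) := by
  classical
  have hs0 : s ≠ 0 := by
    rintro rfl
    simp at hs
  -- In a field of size `2 ^ s`, pairs of a query and an answer correspond exactly to the basis
  -- vectors of `s * m + s` qubits.
  let F := GaloisField 2 s
  have : Fintype F := Fintype.ofFinite F
  have hF : Fintype.card F = 2 ^ s := by
    rw [Fintype.card_eq_nat_card]
    exact GaloisField.card 2 s hs0
  obtain ⟨ε⟩ : Nonempty (Fin n ↪ (Fin m → Bool)) :=
    Function.Embedding.nonempty_of_card_le (by simpa using hn)
  have hT : Fintype.card {t : F // t ≠ 0} = 2 ^ s - 1 := by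
    rw [Fintype.card_subtype_compl, hF, Fintype.card_subtype_eq]
  let e : Fin (2 ^ s - 1) ≃ {t : F // t ≠ 0} := Fintype.equivOfCardEq (by rw [hT, Fintype.card_fin])
  let eM : Bits (s * m + s) ≃ (Fin m → F) × F := Fintype.equivOfCardEq (by
    simp [hF, ← pow_mul, ← pow_add])
  let eA : Bits (s * m + (s * m + s) * (2 ^ s - 1)) ≃
      (Fin m → F) × (Fin (2 ^ s - 1) → (Fin m → F) × F) := Fintype.equivOfCardEq (by
    simp only [Fintype.card_fun, Fintype.card_prod, Fintype.card_bool, Fintype.card_fin, hF,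
      ← pow_mul, ← pow_add])
  refine ⟨askProtocol eA eM (fun i r j l => bitPoint (ε i) l + (e j).1 * r l)
    (fun x => multilinearExt ε x) (fun v => decide (-v = 1)), ?_, ?_, ?_, rfl, rfl, rfl⟩
  · refine askProtocol_computes eA eM (by omega) fun i x r => ?_
    obtain ⟨p, hp, heval⟩ := exists_polynomial_multilinearExt ε x (bitPoint (ε i) : Fin m → F) r
    simp only [← heval]
    -- The hypothesis `m + 2 ≤ 2 ^ s` gives degree at most `m < |F| - 1`.
    rw [e.sum_comp fun t => p.eval t.1, sum_ne_zero_eval_eq (by omega), heval, neg_neg]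
    simp only [zero_mul, add_zero]
    rw [multilinearExt_bitPoint ε.injective, index]
    cases x i <;> simp
  · intro μ hμ
    refine askProtocol_lossA_eq_zero eA eM (fun i j => ?_) hμ
    rw [Fintype.bijective_iff_injective_and_card]
    refine ⟨fun r r' h => funext fun l => ?_, rfl⟩
    have := congrFun h l
    -- The point `t = 0`, which would reveal the index, is never queried.
    exact mul_left_cancel₀ (e j).2 (add_left_cancel this)
  · exact coinProtocol_sum_normSq fun i => askInit_injective eA eM _

/-! ### Asymptotics of the parameters -/

theorem clog_two_lt (n : ℕ) (hn : 1 ≤ n) : (Nat.clog 2 n : ℝ) < Real.logb 2 n + 1 := by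
  rw [← Real.natCeil_logb_natCast]
  exact Nat.ceil_lt_add_one (Real.logb_nonneg one_lt_two (by exact_mod_cast hn))

theorem two_pow_clog_le {k : ℕ} (hk : 2 ≤ k) : 2 ^ Nat.clog 2 k ≤ 2 * k := by
  have h := Nat.pow_pred_clog_lt_self one_lt_two hk
  have h0 : 0 < Nat.clog 2 k := Nat.clog_pos one_lt_two hk
  obtain ⟨l, hl⟩ := Nat.exists_eq_add_of_le' h0
  rw [hl, Nat.pred_succ] at h
  rw [hl, pow_succ]
  omega

/-- Bounds on the parameters of the protocol in terms of `log n` and `log (log n)`. -/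
theorem parameter_bounds {n : ℕ} (hn : 16 ≤ n) :
    2 ≤ Real.logb 2 (Real.logb 2 n) ∧ Real.logb 2 (Real.logb 2 n) ≤ Real.logb 2 n ∧
      (Nat.clog 2 n + 2 : ℝ) ≤ 2 * Real.logb 2 n ∧
      (Nat.clog 2 (Nat.clog 2 n + 2) : ℝ) ≤ 2 * Real.logb 2 (Real.logb 2 n) ∧
      ((2 ^ Nat.clog 2 (Nat.clog 2 n + 2) - 1 : ℕ) : ℝ) ≤ 4 * Real.logb 2 n := by
  have hn' : (16 : ℝ) ≤ n := by exact_mod_cast hn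
  have hL : 4 ≤ Real.logb 2 n := by
    rw [Real.le_logb_iff_rpow_le one_lt_two (by linarith)]
    norm_num
    exact hn
  have hLL : 2 ≤ Real.logb 2 (Real.logb 2 n) := by
    rw [Real.le_logb_iff_rpow_le one_lt_two (by linarith)]
    norm_num
    exact hL
  have hm : (Nat.clog 2 n + 2 : ℝ) ≤ 2 * Real.logb 2 n := by
    have := clog_two_lt n (by omega)
    linarith
  refine ⟨hLL, ?_, hm, ?_, ?_⟩
  · rw [Real.logb_le_iff_le_rpow one_lt_two (by linarith)]
    -- Bernoulli's inequality `1 + L ≤ 2 ^ L` for `L = log n`.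
    have h := one_add_mul_self_le_rpow_one_add (s := 1) (by norm_num) (p := Real.logb 2 n)
      (by linarith)
    norm_num at h
    linarith
  · have h1 := clog_two_lt (Nat.clog 2 n + 2) (by omega)
    have h2 : Real.logb 2 ((Nat.clog 2 n + 2 : ℕ) : ℝ) ≤ Real.logb 2 (2 * Real.logb 2 n) := by
      refine Real.logb_le_logb_of_le one_lt_two (by positivity) ?_
      push_cast
      exact hm
    rw [Real.logb_mul two_ne_zero (by linarith), Real.logb_self_eq_one one_lt_two] at h2
    linarith
  · have h1 := two_pow_clog_le (k := Nat.clog 2 n + 2) (by omega)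
    have h2 : ((2 ^ Nat.clog 2 (Nat.clog 2 n + 2) - 1 : ℕ) : ℝ) ≤
        ((2 * (Nat.clog 2 n + 2) : ℕ) : ℝ) := by
      exact_mod_cast (Nat.sub_le _ _).trans h1
    push_cast at h2
    linarith

end QPIR

theorem mainTheorem4 :
    ∃ π : (n : ℕ) → QPIR.Protocol (Fin n) (Fin n → Bool) Bool,
      (∀ n, (π n).Computes (QPIR.index n)) ∧
      ((fun n => ((π n).communication : ℝ)) =O[atTop]
        fun n : ℕ => Real.logb 2 n ^ 2 * Real.logb 2 (Real.logb 2 n)) ∧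
      (∀ n, ∀ μ ∈ stdSimplex ℝ (Fin n × (Fin n → Bool)), (π n).lossA μ = 0) ∧
      ∃ c : ℕ, ∃ C : ℝ, ∀ᶠ n : ℕ in atTop, ∀ μ ∈ stdSimplex ℝ (Fin n × (Fin n → Bool)),
        (π n).lossB μ ≤ C * Real.logb 2 n ^ c := by
  -- The parameters are `m = ⌈log n⌉` and `s = ⌈log (m + 2)⌉`.
  choose π hcomp hA hnorm hrounds hM hqA using fun n => QPIR.exists_pirProtocol
    (Nat.le_pow_clog one_lt_two n) (Nat.le_pow_clog one_lt_two (Nat.clog 2 n + 2))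
  have hMle : ∀ n ≥ 16, ((π n).qubitsM : ℝ) ≤
      2 * Real.logb 2 (Real.logb 2 n) * (2 * Real.logb 2 n) := by
    intro n hn
    obtain ⟨hLL, -, hm, hs, -⟩ := QPIR.parameter_bounds hn
    rw [hM]
    push_cast
    calc _ = (Nat.clog 2 (Nat.clog 2 n + 2) : ℝ) * (Nat.clog 2 n + 1) := by ring
      _ ≤ _ := mul_le_mul hs (by linarith) (by positivity) (by linarith)
  refine ⟨π, hcomp, ?_, hA, 4, 360, ?_⟩
  -- With `L = log n`: at most `2 * 4 L` rounds of at most `4 L log L` qubits.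
  · refine IsBigO.of_bound 32 ?_
    filter_upwards [eventually_ge_atTop 16] with n hn
    obtain ⟨hLL, hle, -, -, hN⟩ := QPIR.parameter_bounds hn
    have h := mul_le_mul hN (hMle n hn) (by positivity) (by linarith)
    rw [Real.norm_of_nonneg (by positivity), Real.norm_of_nonneg
      (mul_nonneg (by positivity) (by linarith)), QPIR.Protocol.communication, hrounds]
    push_cast at h ⊢
    linarith
  · filter_upwards [eventually_ge_atTop 16] with n hn μ hμ
    obtain ⟨hLL, hle, -, -, hN⟩ := QPIR.parameter_bounds hn
    have : Nonempty (Fin n) := ⟨⟨0, by omega⟩⟩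
    refine ((π n).lossB_le hμ (hnorm n)).trans ?_
    rw [Fintype.card_fin]
    have hM' := hMle n hn
    set L := Real.logb 2 n with hL
    have hL2 : 2 ≤ L := hLL.trans hle
    have hM2 : ((π n).qubitsM : ℝ) ≤ 4 * L ^ 2 := by nlinarith
    have hA2 : ((π n).qubitsA : ℝ) ≤ 4 * L ^ 2 + 4 * L ^ 2 * (4 * L) := by
      have h1 : (π n).qubitsA ≤ (π n).qubitsM +
          (π n).qubitsM * (2 ^ Nat.clog 2 (Nat.clog 2 n + 2) - 1) := by
        rw [hqA, hM]
        exact Nat.add_le_add_right (Nat.le_add_right _ _) _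
      have h2 := mul_le_mul hM2 hN (by positivity) (by positivity)
      have h3 : ((π n).qubitsA : ℝ) ≤ (π n).qubitsM +
          (π n).qubitsM * ((2 ^ Nat.clog 2 (Nat.clog 2 n + 2) - 1 : ℕ) : ℝ) := by
        exact_mod_cast h1
      linarith
    have hR : ((π n).rounds : ℝ) ≤ 8 * L := by
      rw [hrounds, Nat.cast_mul, Nat.cast_ofNat]
      linarith
    -- The sum is at most `32 L ^ 3 + 12 L ^ 2 + L`, and `L ≥ 2` absorbs the lower powers.
    -- Multiplying by the `8 L` rounds gives `360 L ^ 4`.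
    have hT : (π n).qubitsM + 2 * (π n).qubitsA + L ≤ 45 * L ^ 3 := by
      have h1 : L ^ 2 * 2 ≤ L ^ 2 * L := mul_le_mul_of_nonneg_left hL2 (by positivity)
      have h2 : L * 2 ≤ L * L := mul_le_mul_of_nonneg_left hL2 (by positivity)
      nlinarith
    calc _ ≤ 8 * L * (45 * L ^ 3) := mul_le_mul hR hT (by positivity) (by positivity)
      _ = 360 * L ^ 4 := by ring
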